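/- Let $\text{2-Cat}$ be the category of small (strict) 2-categories and (strict) 2-functors. For 2-categories $B, C$ let $Ps(B,C)$ be the 2-category of 2-functors $B \to C$, pseudonatural transformations and modifications, and let $[B,C]_f$ be the 2-category with objects the 2-functors $B \to C$ and hom-categories $[B,C]_f(F,G)=\prod_{x \in B} C(Fx,Gx)$. Let $J_2 : Ps(B,C) \to [B,C]_f$ be the 2-functor that is the identity on objects and forgets the 2-cell components of pseudonatural transformations. For a 2-category $D$ let $\mathrm{ob}D$ be the discrete 2-category on the objects of $D$, with inclusion $i : \mathrm{ob}D \to D$. The funny tensor product $A \star B$ is the pushout in $\text{2-Cat}$ of $1 \times i : \mathrm{ob}A \times \mathrm{ob}B \to \mathrm{ob}A \times B$ and $i \times 1 : \mathrm{ob}A \times \mathrm{ob}B \to A \times \mathrm{ob}B$; it comes with a bijection $\text{2-Cat}(A \star B, C) \cong \text{2-Cat}(A,[B,C]_f)$, natural in $C$. The Gray tensor product $A \otimes B$ is a representing object for the functor $\text{2-Cat}(A, Ps(B,-)) : \text{2-Cat} \to \mathrm{Set}$, so that $\text{2-Cat}(A \otimes B, C) \cong \text{2-Cat}(A, Ps(B,C))$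 naturally in $C$. Under these bijections, composition with $J_2$ is a map $\text{2-Cat}(A \otimes B, C) \to \text{2-Cat}(A \star B, C)$ natural in $C$; let $P : A \star B \to A \otimes B$ be the unique 2-functor such that this map is precomposition with $P$. Then, for all small 2-categories $A$ and $B$, the 2-functor $P : A \star B \to A \otimes B$ is boba: it is bijective on objects and bijective on 1-cells, i.e. it induces an isomorphism of underlying categories. -/

import Mathlib

open CategoryTheory Bicategory Limits Opposite

universe u

/-- A small 2-category: a strict bicategory whose objects, 1-cells and 2-cells are all `u`-small. -/
structure TwoCat : Type (u + 1) where
  carrier : Type u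
  [bicategory : Bicategory.{u, u} carrier]
  [strict : Bicategory.Strict carrier]

namespace TwoCat

instance : CoeSort TwoCat.{u} (Type u) := ⟨TwoCat.carrier⟩

attribute [instance] TwoCat.bicategory TwoCat.strict

section ext

universe w₁ w₂ v₁ v₂ u₁ u₂

variable {B : Type u₁} [Bicategory.{w₁, v₁} B] {C : Type u₂} [Bicategory.{w₂, v₂} C]

theorem ext_of_prelax {F G : StrictPseudofunctor B C}
    (h : F.toPrelaxFunctor = G.toPrelaxFunctor) : F = G := by
  obtain ⟨⟨⟨F, i, c, _, _, _, _, _⟩, hi, hi'⟩, hc, hc'⟩ := F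
  obtain ⟨⟨⟨G, i', c', _, _, _, _, _⟩, ki, ki'⟩, kc, kc'⟩ := G
  dsimp only at h
  subst h
  obtain rfl : @i = @i' := by
    funext a; exact (hi' a).trans (ki' a).symm
  obtain rfl : @c = @c' := by
    funext a b d f g; exact (hc' f g).trans (kc' f g).symm
  rfl

theorem twoFunctor_ext {F G : StrictPseudofunctor B C}
    (hobj : ∀ x, F.obj x = G.obj x)
    (hmap : ∀ {x y : B} (f : x ⟶ y), F.map f ≍ G.map f)
    (hmap₂ : ∀ {x y : B} {f g : x ⟶ y} (η : f ⟶ g), F.map₂ η ≍ G.map₂ η) : F = G := by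
  apply ext_of_prelax
  obtain ⟨⟨⟨⟨⟨⟨Fo, Fm⟩, Fn⟩, _, _⟩, i, c, _, _, _, _, _⟩, hi, hi'⟩, hc, hc'⟩ := F
  obtain ⟨⟨⟨⟨⟨⟨Go, Gm⟩, Gn⟩, _, _⟩, i', c', _, _, _, _, _⟩, ki, ki'⟩, kc, kc'⟩ := G
  obtain rfl : Fo = Go := funext hobj
  obtain rfl : @Fm = @Gm := by
    funext x y f; exact eq_of_heq (hmap f)
  obtain rfl : @Fn = @Gn := by
    funext x y f g η; exact eq_of_heq (hmap₂ η)
  rfl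

end ext

/-- The category `2-Cat` of small 2-categories and (strict) 2-functors. -/
instance : Category TwoCat.{u} where
  Hom A B := StrictPseudofunctor A B
  id A := StrictPseudofunctor.id A
  comp F G := F.comp G
  id_comp _ := twoFunctor_ext (fun _ => rfl) (fun _ => HEq.rfl) (fun _ => HEq.rfl)
  comp_id _ := twoFunctor_ext (fun _ => rfl) (fun _ => HEq.rfl) (fun _ => HEq.rfl)
  assoc _ _ _ := twoFunctor_ext (fun _ => rfl) (fun _ => HEq.rfl) (fun _ => HEq.rfl)

/-- The discrete 2-category `ob A` with the same objects as `A`: its only 1-cells and 2-cells are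
identities. -/
def ob (A : TwoCat.{u}) : TwoCat.{u} := ⟨LocallyDiscrete (Discrete A)⟩

/-- The cartesian product of 2-categories. -/
def prod (A B : TwoCat.{u}) : TwoCat.{u} := ⟨A × B⟩

attribute [local simp] Strict.leftUnitor_eqToIso Strict.rightUnitor_eqToIso
  Strict.associator_eqToIso PrelaxFunctor.map₂_eqToHom

/-- The inclusion `i : ob A ⟶ A`. -/
def incl (A : TwoCat.{u}) : ob A ⟶ A :=
  StrictPseudofunctor.mk'' (B := LocallyDiscrete (Discrete A)) (C := A)
    { obj := fun x => x.as.as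
      map := fun p => eqToHom (Discrete.eq_of_hom p.as)
      map₂ := fun θ => eqToHom (by rw [LocallyDiscrete.eq_of_hom θ])
      map₂_id := by intros; rfl
      map₂_comp := by intros; simp
      map_id := by intros; rfl
      map_comp := by intros; simp
      map₂_whisker_left := by intros; simp
      map₂_whisker_right := by intros; simp }

/-- The product `F × G` of 2-functors. -/
def prodMap {A A' B B' : TwoCat.{u}} (F : A ⟶ A') (G : B ⟶ B') : prod A B ⟶ prod A' B' :=
  StrictPseudofunctor.mk'' (B := A × B) (C := A' × B')
    { obj := fun x => (F.obj x.1, G.obj x.2)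
      map := fun f => (F.map f.1, G.map f.2)
      map₂ := fun η => (F.map₂ η.1, G.map₂ η.2)
      map₂_id := by intros; simp
      map₂_comp := by intros; simp
      map_id := by intros; simp [F.map_id, G.map_id]
      map_comp := by intros; simp [F.map_comp, G.map_comp]
      map₂_whisker_left := by
        intros; simp [F.mapComp_eq_eqToIso, G.mapComp_eq_eqToIso]
      map₂_whisker_right := by
        intros; simp [F.mapComp_eq_eqToIso, G.mapComp_eq_eqToIso] }

section Hom

universe w₁ w₂ v₁ v₂ u₁ u₂

variable {B : Type u₁} [Bicategory.{w₁, v₁} B] {C : Type u₂} [Bicategory.{w₂, v₂} C]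

open scoped Pseudofunctor.StrongTrans

theorem strongTrans_eq {F G : Pseudofunctor B C} {α β : F ⟶ G} (Γ : α ⟶ β)
    (happ : ∀ x, α.app x = β.app x) (hΓ : ∀ x, Γ.as.app x = eqToHom (happ x)) : α = β := by
  obtain ⟨⟨Γ, hn⟩⟩ := Γ
  obtain ⟨a, n, _, _, _⟩ := α
  obtain ⟨b, m, _, _, _⟩ := β
  obtain rfl : a = b := funext happ
  obtain rfl : Γ = fun x => 𝟙 _ := funext hΓ
  obtain rfl : @n = @m := by
    funext x y f
    ext
    simpa using (hn f).symm
  rfl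

theorem eqToHom_as_app {F G : Pseudofunctor B C} {α β : F ⟶ G} (h : α = β) (x : B) :
    (eqToHom h).as.app x = eqToHom (by rw [h]) := by
  subst h
  rfl

instance [Strict C] : Strict (Pseudofunctor B C) where
  id_comp α := strongTrans_eq (λ_ α).hom (fun _ => Strict.id_comp _)
    (fun _ => congrArg Iso.hom (Strict.leftUnitor_eqToIso _))
  comp_id α := strongTrans_eq (ρ_ α).hom (fun _ => Strict.comp_id _)
    (fun _ => congrArg Iso.hom (Strict.rightUnitor_eqToIso _))
  assoc α β γ := strongTrans_eq (α_ α β γ).hom (fun _ => Strict.assoc _ _ _)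
    (fun _ => congrArg Iso.hom (Strict.associator_eqToIso _ _ _))
  leftUnitor_eqToIso α := by
    ext x
    rw [eqToIso.hom, eqToHom_as_app]
    exact (congrArg Iso.hom (Strict.leftUnitor_eqToIso _))
  rightUnitor_eqToIso α := by
    ext x
    rw [eqToIso.hom, eqToHom_as_app]
    exact (congrArg Iso.hom (Strict.rightUnitor_eqToIso _))
  associator_eqToIso α β γ := by
    ext x
    rw [eqToIso.hom, eqToHom_as_app]
    exact (congrArg Iso.hom (Strict.associator_eqToIso _ _ _))

end Hom

open scoped Pseudofunctor.StrongTrans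

/-- The objects of `Ps(B, C)`, that is, 2-functors from `B` to `C`. As an induced bicategory of the
bicategory of pseudofunctors, `Ps(B, C)` has the pseudonatural (strong) transformations as 1-cells
and the modifications as 2-cells. -/
abbrev PsObj (B C : TwoCat.{u}) : Type u :=
  InducedBicategory (Pseudofunctor B C)
    (fun F : StrictPseudofunctor B C => F.toPseudofunctor)

/-- The 2-category `Ps(B, C)` of 2-functors, pseudonatural transformations and modifications. -/
def Ps (B C : TwoCat.{u}) : TwoCat.{u} := ⟨PsObj B C⟩

/-- The objects of `[B, C]_f`, that is, 2-functors from `B` to `C`. -/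
structure FunnyHom (B C : TwoCat.{u}) : Type u where
  as : StrictPseudofunctor B C

namespace FunnyHom

variable {B C : TwoCat.{u}}

/-- A transformation of 2-functors: a family of 1-cells, subject to no axioms. -/
structure Transformation (F G : FunnyHom B C) : Type u where
  app (x : B) : F.as.obj x ⟶ G.as.obj x

/-- A 2-cell of transformations: a family of 2-cells, subject to no axioms. -/
@[ext]
structure Family {F G : FunnyHom B C} (α β : Transformation F G) : Type u where
  app (x : B) : α.app x ⟶ β.app x

instance : CategoryStruct (FunnyHom B C) where
  Hom F G := Transformation F G
  id F := ⟨fun x => 𝟙 (F.as.obj x)⟩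
  comp α β := ⟨fun x => α.app x ≫ β.app x⟩

instance (F G : FunnyHom B C) : Category (F ⟶ G) where
  Hom α β := Family α β
  id α := ⟨fun x => 𝟙 (α.app x)⟩
  comp Γ Θ := ⟨fun x => Γ.app x ≫ Θ.app x⟩

@[ext]
theorem hom₂_ext {F G : FunnyHom B C} {α β : F ⟶ G} {Γ Θ : α ⟶ β}
    (h : ∀ x, Γ.app x = Θ.app x) : Γ = Θ :=
  Family.ext (funext h)

@[simp] theorem id_app (F : FunnyHom B C) (x : B) : (𝟙 F : F ⟶ F).app x = 𝟙 (F.as.obj x) := rfl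

@[simp] theorem comp_app {F G H : FunnyHom B C} (α : F ⟶ G) (β : G ⟶ H) (x : B) :
    (α ≫ β).app x = α.app x ≫ β.app x := rfl

@[simp] theorem id₂_app {F G : FunnyHom B C} (α : F ⟶ G) (x : B) :
    (𝟙 α : α ⟶ α).app x = 𝟙 (α.app x) := rfl

@[simp] theorem comp₂_app {F G : FunnyHom B C} {α β γ : F ⟶ G} (Γ : α ⟶ β) (Θ : β ⟶ γ) (x : B) :
    (Γ ≫ Θ).app x = Γ.app x ≫ Θ.app x := rfl

theorem eqToHom_app {F G : FunnyHom B C} {α β : F ⟶ G} (h : α = β) (x : B) :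
    (eqToHom h).app x = eqToHom (by rw [h]) := by
  subst h
  rfl

/-- An invertible family of 2-cells, from its invertible components. -/
@[simps]
def isoMk {F G : FunnyHom B C} {α β : F ⟶ G} (e : ∀ x, α.app x ≅ β.app x) : α ≅ β where
  hom := Family.mk fun x => (e x).hom
  inv := Family.mk fun x => (e x).inv

/-- Left whiskering, computed componentwise. -/
@[simps]
def whiskerLeft {F G H : FunnyHom B C} (α : F ⟶ G) {β γ : G ⟶ H} (Γ : β ⟶ γ) :
    α ≫ β ⟶ α ≫ γ where
  app x := α.app x ◁ Γ.app x

/-- Right whiskering, computed componentwise. -/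
@[simps]
def whiskerRight {F G H : FunnyHom B C} {α β : F ⟶ G} (Γ : α ⟶ β) (γ : G ⟶ H) :
    α ≫ γ ⟶ β ≫ γ where
  app x := Γ.app x ▷ γ.app x

/-- The associators, computed componentwise. -/
@[simps!]
def associator {F G H K : FunnyHom B C} (α : F ⟶ G) (β : G ⟶ H) (γ : H ⟶ K) :
    (α ≫ β) ≫ γ ≅ α ≫ β ≫ γ :=
  isoMk fun x => α_ (α.app x) (β.app x) (γ.app x)

/-- The left unitors, computed componentwise. -/
@[simps!]
def leftUnitor {F G : FunnyHom B C} (α : F ⟶ G) : 𝟙 F ≫ α ≅ α :=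
  isoMk fun x => λ_ (α.app x)

/-- The right unitors, computed componentwise. -/
@[simps!]
def rightUnitor {F G : FunnyHom B C} (α : F ⟶ G) : α ≫ 𝟙 G ≅ α :=
  isoMk fun x => ρ_ (α.app x)

instance : Bicategory.{u, u} (FunnyHom B C) where
  whiskerLeft α _ _ Γ := whiskerLeft α Γ
  whiskerRight Γ γ := whiskerRight Γ γ
  associator α β γ := associator α β γ
  leftUnitor α := leftUnitor α
  rightUnitor α := rightUnitor α
  whisker_exchange _ _ := hom₂_ext fun _ => whisker_exchange _ _

instance : Strict (FunnyHom B C) where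
  id_comp _ := congrArg Transformation.mk (funext fun _ => Strict.id_comp _)
  comp_id _ := congrArg Transformation.mk (funext fun _ => Strict.comp_id _)
  assoc _ _ _ := congrArg Transformation.mk (funext fun _ => Strict.assoc _ _ _)
  leftUnitor_eqToIso _ := by
    ext x
    rw [eqToIso.hom, eqToHom_app]
    exact (congrArg Iso.hom (Strict.leftUnitor_eqToIso _))
  rightUnitor_eqToIso _ := by
    ext x
    rw [eqToIso.hom, eqToHom_app]
    exact (congrArg Iso.hom (Strict.rightUnitor_eqToIso _))
  associator_eqToIso _ _ _ := by
    ext x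
    rw [eqToIso.hom, eqToHom_app]
    exact (congrArg Iso.hom (Strict.associator_eqToIso _ _ _))

end FunnyHom

/-- The 2-category `[B, C]_f` with 2-functors as objects and hom-categories the products
`∏ x, C(F x, G x)`. -/
def funnyHom (B C : TwoCat.{u}) : TwoCat.{u} := ⟨FunnyHom B C⟩

/-- The 2-functor `J₂ : Ps(B, C) ⟶ [B, C]_f` that forgets the 2-cell components of pseudonatural
transformations. -/
def forgetPs (B C : TwoCat.{u}) : Ps B C ⟶ funnyHom B C :=
  StrictPseudofunctor.mk'' (B := PsObj B C) (C := FunnyHom B C)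
    { obj := fun F => ⟨F⟩
      map := fun α => FunnyHom.Transformation.mk fun x => α.hom.app x
      map₂ := fun Γ => FunnyHom.Family.mk fun x => Γ.hom.as.app x
      map₂_id := by intros; rfl
      map₂_comp := by intros; rfl
      map_id := by intros; rfl
      map_comp := by intros; rfl
      map₂_whisker_left := by
        intros; exact FunnyHom.hom₂_ext fun x => by
          erw [eqToHom_refl, eqToHom_refl, Category.id_comp, Category.comp_id]; rfl
      map₂_whisker_right := by
        intros; exact FunnyHom.hom₂_ext fun x => by
          erw [eqToHom_refl, eqToHom_refl, Category.id_comp, Category.comp_id]; rfl }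


section Post

universe w₁ w₂ w₃ v₁ v₂ v₃ u₁ u₂ u₃

variable {B : Type u₁} [Bicategory.{w₁, v₁} B] {C : Type u₂} [Bicategory.{w₂, v₂} C]
  {D : Type u₃} [Bicategory.{w₃, v₃} D]

open scoped Pseudofunctor.StrongTrans

/-- The composite of a strong transformation `α` with a pseudofunctor `F`. -/
@[simps]
def postcompTrans {G H : Pseudofunctor B C}
    (α : G ⟶ H) (F : Pseudofunctor C D) :
    (G.comp F) ⟶ (H.comp F) where
  app x := F.map (α.app x)
  naturality f := (F.mapComp _ _).symm ≪≫ F.map₂Iso (α.naturality f) ≪≫ F.mapComp _ _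
  naturality_naturality {x y f g} η := by
    have := congrArg F.map₂ (α.naturality_naturality η)
    simp only [F.map₂_comp, F.map₂_whisker_right, F.map₂_whisker_left, Category.assoc] at this
    have h := (F.mapComp _ _).inv ≫= this =≫ (F.mapComp _ _).hom
    change F.map₂ (G.map₂ η) ▷ F.map (α.app y) ≫ (F.mapComp (G.map g) (α.app y)).inv ≫
      F.map₂ (α.naturality g).hom ≫ (F.mapComp (α.app x) (H.map g)).hom =
      ((F.mapComp (G.map f) (α.app y)).inv ≫ F.map₂ (α.naturality f).hom ≫
        (F.mapComp (α.app x) (H.map f)).hom) ≫ F.map (α.app x) ◁ F.map₂ (H.map₂ η)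
    simpa using h
  naturality_id := by
    intro x
    have := congrArg F.map₂ (α.naturality_id x)
    have hr : F.map₂ (ρ_ (α.app x)).inv = (ρ_ (F.map (α.app x))).inv ≫
      F.map (α.app x) ◁ (F.mapId _).inv ≫ (F.mapComp _ _).inv := by
        rw [← cancel_mono (F.map₂ (ρ_ (α.app x)).hom), ← F.map₂_comp]
        simp [F.map₂_right_unitor]
    simp only [F.map₂_comp, F.map₂_whisker_right, F.map₂_whisker_left, Category.assoc,
      F.map₂_left_unitor, hr] at this
    have h := (F.mapComp _ _).inv ≫= this =≫ ((F.mapComp _ _).hom ≫ _ ◁ (F.mapId _).hom)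
    change ((F.mapComp (G.map (𝟙 x)) (α.app x)).inv ≫ F.map₂ (α.naturality (𝟙 x)).hom ≫
        (F.mapComp (α.app x) (H.map (𝟙 x))).hom) ≫
          F.map (α.app x) ◁ (F.map₂ (H.mapId x).hom ≫ (F.mapId (H.obj x)).hom) =
      (F.map₂ (G.mapId x).hom ≫ (F.mapId (G.obj x)).hom) ▷ F.map (α.app x) ≫
      (λ_ (F.map (α.app x))).hom ≫ (ρ_ (F.map (α.app x))).inv
    simpa using h
  naturality_comp := by
    intro x y z f g
    have := congrArg F.map₂ (α.naturality_comp f g)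
    have hr : F.map₂ (α_ (G.map f) (α.app y) (H.map g)).inv = (F.mapComp _ _).hom ≫
      F.map (G.map f) ◁ (F.mapComp (α.app y) (H.map g)).hom ≫ (α_ _ _ _).inv ≫
        (F.mapComp _ _).inv ▷ _ ≫ (F.mapComp _ _).inv := by
      rw [← cancel_mono (F.map₂ (α_ (G.map f) (α.app y) (H.map g)).hom), ← F.map₂_comp]
      simp [F.map₂_associator]
    simp only [F.map₂_comp, F.map₂_whisker_right, F.map₂_whisker_left, Category.assoc,
      F.map₂_associator, hr] at this
    have h := (F.mapComp _ _).inv ≫= this =≫ ((F.mapComp _ _).hom ≫ _ ◁ (F.mapComp _ _).hom)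
    change ((F.mapComp (G.map (f ≫ g)) (α.app z)).inv ≫ F.map₂ (α.naturality (f ≫ g)).hom ≫
        (F.mapComp (α.app x) (H.map (f ≫ g))).hom) ≫
          F.map (α.app x) ◁ (F.map₂ (H.mapComp f g).hom ≫ (F.mapComp (H.map f) (H.map g)).hom) =
      (F.map₂ (G.mapComp f g).hom ≫ (F.mapComp (G.map f) (G.map g)).hom) ▷ F.map (α.app z) ≫
      (α_ (F.map (G.map f)) (F.map (G.map g)) (F.map (α.app z))).hom ≫
        F.map (G.map f) ◁ ((F.mapComp (G.map g) (α.app z)).inv ≫ F.map₂ (α.naturality g).hom ≫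
          (F.mapComp (α.app y) (H.map g)).hom) ≫
        (α_ (F.map (G.map f)) (F.map (α.app y)) (F.map (H.map g))).inv ≫
        ((F.mapComp (G.map f) (α.app y)).inv ≫ F.map₂ (α.naturality f).hom ≫
          (F.mapComp (α.app x) (H.map f)).hom) ▷ F.map (H.map g) ≫
        (α_ (F.map (α.app x)) (F.map (H.map f)) (F.map (H.map g))).hom
    simpa using h

/-- The composite of a modification `Γ` with a pseudofunctor `F`. -/
@[simps]
def postcompMod {G H : Pseudofunctor B C} {α β : G ⟶ H} (Γ : α ⟶ β) (F : Pseudofunctor C D) :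
    postcompTrans α F ⟶ postcompTrans β F where
  as :=
    { app := fun x => F.map₂ (Γ.as.app x)
      naturality := fun {x y} f => by
        have := congrArg F.map₂ (Γ.as.naturality f)
        simp only [F.map₂_comp, F.map₂_whisker_right, F.map₂_whisker_left, Category.assoc] at this
        have h := (F.mapComp _ _).inv ≫= this =≫ (F.mapComp _ _).hom
        change F.map (G.map f) ◁ F.map₂ (Γ.as.app y) ≫ (F.mapComp (G.map f) (β.app y)).inv ≫
            F.map₂ (β.naturality f).hom ≫ (F.mapComp (β.app x) (H.map f)).hom =
          ((F.mapComp (G.map f) (α.app y)).inv ≫ F.map₂ (α.naturality f).hom ≫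
            (F.mapComp (α.app x) (H.map f)).hom) ≫ F.map₂ (Γ.as.app x) ▷ F.map (H.map f)
        simpa using h }

theorem strongTrans_ext {F G : Pseudofunctor B C} {α β : F ⟶ G}
    (happ : ∀ x, α.app x = β.app x)
    (hnat : ∀ {x y : B} (f : x ⟶ y), (α.naturality f).hom =
      eqToHom (by rw [happ]) ≫ (β.naturality f).hom ≫ eqToHom (by rw [happ])) : α = β := by
  obtain ⟨a, n, _, _, _⟩ := α
  obtain ⟨b, m, _, _, _⟩ := β
  obtain rfl : a = b := funext happ
  obtain rfl : @n = @m := by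
    funext x y f
    ext
    simpa using hnat f
  rfl

theorem eqToHom_aux {X : Type*} [Category* X] {a b c d : X} (h₁ : a = b) (h₂ : b = c)
    (h₃ : c = d) (h₄ : a = d) :
    eqToHom h₄ = eqToHom h₁ ≫ eqToHom h₂ ≫ eqToHom h₃ := by
  simp

theorem eqToHom_auxTwo {X : Type*} [Category* X] {a b c d e f g h : X} (h₁ : a = c) (h₂ : f = h)
    (u : c ⟶ d) (h₀ : d = e) (v : e ⟶ f) (h₃ : a = b) (h₄ : b = c) (h₅ : f = g) (h₆ : g = h)  :
    eqToHom h₁ ≫ u ≫ eqToHom h₀ ≫ v ≫ eqToHom h₂ =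
      eqToHom h₃ ≫ (eqToHom h₄ ≫ u ≫ eqToHom h₀ ≫ v ≫ eqToHom h₅) ≫ eqToHom h₆ := by
  simp

theorem postcompTrans_id [Strict C] [Strict D] (G : Pseudofunctor B C)
    (F : StrictPseudofunctor C D) :
    postcompTrans (𝟙 G) F.toPseudofunctor = 𝟙 (G.comp F.toPseudofunctor) := by
  refine strongTrans_ext (fun x => F.map_id _) fun f => ?_
  have h : ((𝟙 (G.comp F.toPseudofunctor) : G.comp F.toPseudofunctor ⟶ _).naturality f).hom =
      (ρ_ (F.map (G.map f))).hom ≫ (λ_ (F.map (G.map f))).inv := rfl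
  rw [h]
  have h2 : ((postcompTrans (𝟙 G) F.toPseudofunctor).naturality f).hom =
     (F.mapComp _ _).inv ≫ F.map₂ ((ρ_ (G.map f)).hom ≫ (λ_ (G.map f)).inv) ≫
        (F.mapComp _ _).hom := rfl
  rw [h2]
  simp only [Strict.leftUnitor_eqToIso, Strict.rightUnitor_eqToIso, eqToIso.hom, eqToIso.inv,
    eqToHom_trans, PrelaxFunctor.map₂_eqToHom, F.mapComp_eq_eqToIso]
  exact eqToHom_aux _ _ _ _

theorem postcompTrans_comp [Strict C] [Strict D] {G H K : Pseudofunctor B C} (α : G ⟶ H)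
    (β : H ⟶ K) (F : StrictPseudofunctor C D) :
    postcompTrans (α ≫ β) F.toPseudofunctor =
      postcompTrans α F.toPseudofunctor ≫ postcompTrans β F.toPseudofunctor := by
  refine strongTrans_ext (fun x => F.map_comp _ _) fun {x y} f => ?_
  have h : ((postcompTrans α F.toPseudofunctor ≫
      postcompTrans β F.toPseudofunctor).naturality f).hom =
      (α_ (F.map (G.map f)) (F.map (α.app y)) (F.map (β.app y))).inv ≫
      ((F.mapComp _ _).inv ≫ F.map₂ (α.naturality f).hom ≫ (F.mapComp _ _).hom) ▷ F.map (β.app y) ≫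
      (α_ (F.map (α.app x)) (F.map (H.map f)) (F.map (β.app y))).hom ≫
      F.map (α.app x) ◁ ((F.mapComp _ _).inv ≫ F.map₂ (β.naturality f).hom ≫ (F.mapComp _ _).hom) ≫
      (α_ (F.map (α.app x)) (F.map (β.app x)) (F.map (K.map f))).inv := by
    rw [Pseudofunctor.StrongTrans.categoryStruct_comp_naturality_hom]
    rfl
  rw [h]
  have h2 : ((postcompTrans (α ≫ β) F.toPseudofunctor).naturality f).hom =
     (F.mapComp _ _).inv ≫ F.map₂ ((α_ (G.map f) (α.app y) (β.app y)).inv ≫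
       (α.naturality f).hom ▷ β.app y ≫ (α_ (α.app x) (H.map f) (β.app y)).hom ≫
       α.app x ◁ (β.naturality f).hom ≫ (α_ (α.app x) (β.app x) (K.map f)).inv) ≫
        (F.mapComp _ _).hom := by
    exact congrArg (fun t => (F.mapComp _ _).inv ≫ F.map₂ t ≫ (F.mapComp _ _).hom)
      (Pseudofunctor.StrongTrans.categoryStruct_comp_naturality_hom α β f)
  rw [h2]
  simp [F.mapComp_eq_eqToIso]
  exact eqToHom_auxTwo _ _ _ _ _ _ _ _ _

end Post

theorem ps_conj {B C : TwoCat.{u}} {F G : PsObj B C} {α α' β β' : F ⟶ G} (h₁ : α = α')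
    (Γ : α' ⟶ β') (h₂ : β' = β) (x : B) :
    (eqToHom h₁ ≫ Γ ≫ eqToHom h₂).hom.as.app x =
      eqToHom (by rw [h₁]) ≫ Γ.hom.as.app x ≫ eqToHom (by rw [h₂]) := by
  subst h₁ h₂
  simp

/-- The 2-functor `Ps(B, F) : Ps(B, C) ⟶ Ps(B, D)`, composition with the 2-functor `F`. -/
def psMap (B : TwoCat.{u}) {C D : TwoCat.{u}} (F : C ⟶ D) : Ps B C ⟶ Ps B D :=
  StrictPseudofunctor.mk'' (B := PsObj B C) (C := PsObj B D)
    { obj := fun G => StrictPseudofunctor.comp G F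
      map := fun α => InducedBicategory.mkHom (postcompTrans α.hom F.toPseudofunctor)
      map₂ := fun Γ => InducedBicategory.mkHom₂ (postcompMod Γ.hom F.toPseudofunctor)
      map₂_id := by
        intros; ext x; exact F.map₂_id _
      map₂_comp := by
        intros; ext x; exact F.map₂_comp _ _
      map_id := fun G => congrArg InducedBicategory.mkHom (postcompTrans_id G.toPseudofunctor F)
      map_comp := fun α β => congrArg InducedBicategory.mkHom (postcompTrans_comp α.hom β.hom F)
      map₂_whisker_left := by
        intro _ _ _ α β γ Γ
        apply InducedBicategory.hom₂_ext
        apply Pseudofunctor.StrongTrans.homCategory.ext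
        intro x
        refine Eq.trans ?_ (ps_conj _ _ _ x).symm
        refine (F.map₂_whisker_left (α.hom.app x) (Γ.hom.as.app x)).trans ?_
        rw [F.mapComp_eq_eqToIso, F.mapComp_eq_eqToIso]
        rfl
      map₂_whisker_right := by
        intro _ _ _ α β Γ γ
        apply InducedBicategory.hom₂_ext
        apply Pseudofunctor.StrongTrans.homCategory.ext
        intro x
        refine Eq.trans ?_ (ps_conj _ _ _ x).symm
        refine (F.map₂_whisker_right (Γ.hom.as.app x) (γ.hom.app x)).trans ?_
        rw [F.mapComp_eq_eqToIso, F.mapComp_eq_eqToIso]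
        rfl }

theorem ps_hom_heq {B C : TwoCat.{u}} {F F' G G' : PsObj B C} (hF : F = F') (hG : G = G')
    {α : F ⟶ G} {β : F' ⟶ G'} (happ : ∀ x, α.hom.app x ≍ β.hom.app x)
    (hnat : ∀ {x y : B} (f : x ⟶ y), (α.hom.naturality f).hom ≍ (β.hom.naturality f).hom) :
    α ≍ β := by
  subst hF hG
  apply heq_of_eq
  apply InducedBicategory.hom_ext
  obtain ⟨⟨a, n, _, _, _⟩⟩ := α
  obtain ⟨⟨b, m, _, _, _⟩⟩ := β
  obtain rfl : a = b := funext fun x => eq_of_heq (happ x)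
  obtain rfl : @n = @m := by
    funext x y f
    exact Iso.ext (eq_of_heq (hnat f))
  rfl

theorem ps_hom₂_heq {B C : TwoCat.{u}} {F F' G G' : PsObj B C} (hF : F = F') (hG : G = G')
    {α β : F ⟶ G} {α' β' : F' ⟶ G'} (hα : α ≍ α') (hβ : β ≍ β') {Γ : α ⟶ β} {Γ' : α' ⟶ β'}
    (h : ∀ x, Γ.hom.as.app x ≍ Γ'.hom.as.app x) : Γ ≍ Γ' := by
  subst hF hG hα hβ
  apply heq_of_eq
  apply InducedBicategory.hom₂_ext
  apply Pseudofunctor.StrongTrans.homCategory.ext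
  exact fun x => eq_of_heq (h x)

theorem comp_one {B C : TwoCat.{u}} (G : StrictPseudofunctor B C) : G.comp (𝟙 C) = G :=
  twoFunctor_ext (fun _ => rfl) (fun _ => HEq.rfl) (fun _ => HEq.rfl)

theorem comp_assoc {B C D E : TwoCat.{u}} (G : StrictPseudofunctor B C) (F : C ⟶ D) (K : D ⟶ E) :
    G.comp (F ≫ K) = (G.comp F).comp K :=
  twoFunctor_ext (fun _ => rfl) (fun _ => HEq.rfl) (fun _ => HEq.rfl)

theorem psMap_id_map {B C : TwoCat.{u}} {G H : PsObj B C} (α : G ⟶ H) :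
    (psMap B (𝟙 C)).map α ≍ α := by
  refine ps_hom_heq (comp_one G) (comp_one H) (fun x => HEq.rfl) fun f => ?_
  apply heq_of_eq
  change 𝟙 _ ≫ (α.hom.naturality f).hom ≫ 𝟙 _ = _
  rw [Category.id_comp, Category.comp_id]

theorem psMap_comp_map {B C D E : TwoCat.{u}} (F : C ⟶ D) (K : D ⟶ E) {G H : PsObj B C}
    (α : G ⟶ H) : (psMap B (F ≫ K)).map α ≍ (psMap B K).map ((psMap B F).map α) := by
  refine ps_hom_heq (comp_assoc G F K) (comp_assoc H F K) (fun x => HEq.rfl) fun {x y} f => ?_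
  apply heq_of_eq
  change ((K.mapComp _ _).inv ≫ K.map₂ (F.mapComp _ _).inv) ≫ K.map₂ (F.map₂ _) ≫
    K.map₂ (F.mapComp _ _).hom ≫ (K.mapComp _ _).hom =
    (K.mapComp _ _).inv ≫ K.map₂ ((F.mapComp _ _).inv ≫ F.map₂ _ ≫ (F.mapComp _ _).hom) ≫
      (K.mapComp _ _).hom
  rw [K.map₂_comp, K.map₂_comp]
  simp only [Category.assoc]

/-- The functor `Ps(B, -)` from 2-categories to 2-categories. -/
def psFunctor (B : TwoCat.{u}) : TwoCat.{u} ⥤ TwoCat.{u} where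
  obj C := Ps B C
  map F := psMap B F
  map_id _ := twoFunctor_ext (fun G => comp_one G) psMap_id_map
    (fun _ => ps_hom₂_heq (comp_one _) (comp_one _) (psMap_id_map _) (psMap_id_map _)
      fun _ => HEq.rfl)
  map_comp F K := twoFunctor_ext (fun G => comp_assoc G F K) (psMap_comp_map F K)
    (fun _ => ps_hom₂_heq (comp_assoc _ F K) (comp_assoc _ F K) (psMap_comp_map F K _)
      (psMap_comp_map F K _) fun _ => HEq.rfl)

section Uncurry

variable {A B C : TwoCat.{u}}

theorem aux_left {B C : TwoCat.{u}} (L : StrictPseudofunctor B C) {b b' b'' : B} (g : b ⟶ b')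
    {h h' : b' ⟶ b''} (η : h ⟶ h') (e₁ e₂) :
    L.map₂ (g ◁ η) ▷ 𝟙 _ =
      eqToHom e₁ ≫ (L.map g ≫ 𝟙 _) ◁ (L.map₂ η ▷ 𝟙 _) ≫ eqToHom e₂ := by
  simp [StrictPseudofunctor.mapComp_eq_eqToIso]

theorem aux_right {B C : TwoCat.{u}} (L : StrictPseudofunctor B C) {b b' b'' : B} {g g' : b ⟶ b'}
    (η : g ⟶ g') (h : b' ⟶ b'') (e₁ e₂) :
    L.map₂ (η ▷ h) ▷ 𝟙 _ =
      eqToHom e₁ ≫ (L.map₂ η ▷ 𝟙 _) ▷ (L.map h ≫ 𝟙 _) ≫ eqToHom e₂ := by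
  simp [StrictPseudofunctor.mapComp_eq_eqToIso]

/-- A family of 2-functors `L a : B ⟶ C`, indexed by the objects of `A`, is the same as a 2-functor
`ob A × B ⟶ C`. A 1-cell of `ob A × B` is an equality `a = a'` with a 1-cell `g` of `B`; it is sent
to `L a g`, regarded as a 1-cell into `L a' b'` along that equality. -/
def family (L : A → (B ⟶ C)) : prod (ob A) B ⟶ C :=
  StrictPseudofunctor.mk'' (B := LocallyDiscrete (Discrete A) × B) (C := C)
    { obj := fun x => (L x.1.as.as).obj x.2
      map := fun {x y} f => (L x.1.as.as).map f.2 ≫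
        eqToHom (by rw [Discrete.eq_of_hom f.1.as])
      map₂ := fun {x y f g} η => (L x.1.as.as).map₂ η.2 ▷ _
      map₂_id := by intros; simp
      map₂_comp := by intros; simp
      map_id := by
        intros; simp [StrictlyUnitaryPseudofunctor.map_id]
      map_comp := by
        rintro ⟨⟨⟨a⟩⟩, b⟩ ⟨⟨⟨a'⟩⟩, b'⟩ ⟨⟨⟨a''⟩⟩, b''⟩ ⟨⟨⟨⟨p⟩⟩⟩, g⟩ ⟨⟨⟨⟨p'⟩⟩⟩, g'⟩
        dsimp at p p'
        subst p p'
        simp [StrictPseudofunctor.map_comp]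
      map₂_whisker_left := by
        rintro ⟨⟨⟨a⟩⟩, b⟩ ⟨⟨⟨a'⟩⟩, b'⟩ ⟨⟨⟨a''⟩⟩, b''⟩ ⟨⟨⟨⟨p⟩⟩⟩, g⟩ ⟨⟨⟨⟨p'⟩⟩⟩, g'⟩ ⟨h, h'⟩ ⟨η, η'⟩
        dsimp at p p'
        subst p p'
        exact aux_left _ _ _ _ _
      map₂_whisker_right := by
        rintro ⟨⟨⟨a⟩⟩, b⟩ ⟨⟨⟨a'⟩⟩, b'⟩ ⟨⟨⟨a''⟩⟩, b''⟩ ⟨⟨⟨⟨p⟩⟩⟩, g⟩ ⟨h, h'⟩ ⟨η, η'⟩ ⟨⟨⟨⟨p'⟩⟩⟩, g'⟩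
        dsimp at p p'
        subst p p'
        exact aux_right _ _ _ _ _ }

/-- The symmetry `A × B ⟶ B × A`. -/
def swap (A B : TwoCat.{u}) : prod A B ⟶ prod B A := Bicategory.Prod.swap A B

/-- The evaluation 2-functor `[B, C]_f ⟶ C` at an object `b` of `B`. -/
def evalAt (C : TwoCat.{u}) (b : B) : funnyHom B C ⟶ C :=
  StrictPseudofunctor.mk'' (B := FunnyHom B C) (C := C)
    { obj := fun F => F.as.obj b
      map := fun α => α.app b
      map₂ := fun Γ => Γ.app b
      map₂_id := by intros; rfl
      map₂_comp := by intros; rfl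
      map_id := by intros; rfl
      map_comp := by intros; rfl
      map₂_whisker_left := by
        intros; erw [eqToHom_refl, eqToHom_refl, Category.id_comp, Category.comp_id]; rfl
      map₂_whisker_right := by
        intros; erw [eqToHom_refl, eqToHom_refl, Category.id_comp, Category.comp_id]; rfl }

/-- The 2-functor `ob A × B ⟶ C`, `(a, b) ↦ H a b`, underlying a 2-functor `H : A ⟶ [B, C]_f`. -/
def uncurryLeft (H : A ⟶ funnyHom B C) : prod (ob A) B ⟶ C :=
  family fun a => (H.obj a).as

/-- The 2-functor `A × ob B ⟶ C`, `(a, b) ↦ H a b`, underlying a 2-functor `H : A ⟶ [B, C]_f`. -/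
def uncurryRight (H : A ⟶ funnyHom B C) : prod A (ob B) ⟶ C :=
  swap A (ob B) ≫ family fun b => H ≫ evalAt C b

theorem id_heq {X : Type*} [Category* X] {a b : X} (h : a = b) : 𝟙 a ≍ 𝟙 b := by
  subst h
  rfl

/-- The two 2-functors underlying `H : A ⟶ [B, C]_f` agree on `ob A × ob B`, so they correspond to
a 2-functor from the funny tensor product to `C`. -/
theorem uncurry_w (H : A ⟶ funnyHom B C) :
    prodMap (𝟙 (ob A)) (incl B) ≫ uncurryLeft H = prodMap (incl A) (𝟙 (ob B)) ≫ uncurryRight H := by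
  apply twoFunctor_ext
  · intro x; rfl
  · rintro ⟨⟨⟨a⟩⟩, ⟨⟨b⟩⟩⟩ ⟨⟨⟨a'⟩⟩, ⟨⟨b'⟩⟩⟩ ⟨⟨⟨⟨p⟩⟩⟩, ⟨⟨⟨q⟩⟩⟩⟩
    dsimp at p q
    subst p q
    apply heq_of_eq
    change (H.obj a).as.map (𝟙 b) ≫ 𝟙 _ = (H.map (𝟙 a)).app b ≫ 𝟙 _
    rw [(H.obj a).as.map_id, H.map_id]
    rfl
  · rintro ⟨⟨⟨a⟩⟩, ⟨⟨b⟩⟩⟩ ⟨⟨⟨a'⟩⟩, ⟨⟨b'⟩⟩⟩ ⟨⟨⟨⟨p⟩⟩⟩, ⟨⟨⟨q⟩⟩⟩⟩ ⟨⟨⟨⟨p'⟩⟩⟩, ⟨⟨⟨q'⟩⟩⟩⟩ ⟨θ, θ'⟩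
    dsimp at p q
    subst p q
    change (H.obj a).as.map₂ (𝟙 (𝟙 b)) ▷ 𝟙 _ ≍ (H.map₂ (𝟙 (𝟙 a))).app b ▷ 𝟙 _
    rw [(H.obj a).as.map₂_id, H.map₂_id, id_whiskerRight]
    refine HEq.trans ?_ (heq_of_eq (id_whiskerRight ((H.map (𝟙 a)).app b) (𝟙 _)).symm)
    have h : (H.obj a).as.map (𝟙 b) ≫ 𝟙 _ = (H.map (𝟙 a)).app b ≫ 𝟙 _ := by
      rw [(H.obj a).as.map_id, H.map_id]
      rfl
    exact id_heq h

end Uncurry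

section Tensor

variable {A B S G : TwoCat.{u}}

/-- `inl` and `inr` exhibit `S` as the funny tensor product of `A` and `B`: the square
```
ob A × ob B --1 × i--> ob A × B
     |                    |
   i × 1                 inl
     v                    v
 A × ob B  ---inr--->     S
```
is a pushout in the category of 2-categories and 2-functors. -/
def IsFunnyTensor (inl : prod (ob A) B ⟶ S) (inr : prod A (ob B) ⟶ S) : Prop :=
  IsPushout (prodMap (𝟙 (ob A)) (incl B)) (prodMap (incl A) (𝟙 (ob B))) inl inr

/-- A Gray tensor product of `A` and `B` is a representing object `G` of the functor
`2-Cat(A, Ps(B, -))` from 2-categories to sets: the data of a bijection between 2-functors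
`G ⟶ C` and 2-functors `A ⟶ Ps(B, C)`, natural in `C`. -/
abbrev GrayTensor (A B G : TwoCat.{u}) : Type (u + 1) :=
  (psFunctor B ⋙ coyoneda.obj (op A)).CorepresentableBy G

/-- The 2-functor `A ⟶ Ps(B, C)` corresponding to a 2-functor `G ⟶ C`. -/
def GrayTensor.transpose (hG : GrayTensor A B G) {C : TwoCat.{u}} (F : G ⟶ C) : A ⟶ Ps B C :=
  hG.homEquiv F

theorem GrayTensor.transpose_eq (hG : GrayTensor A B G) {C : TwoCat.{u}} (F : G ⟶ C) :
    hG.transpose F = hG.transpose (𝟙 G) ≫ psMap B F := by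
  have h := hG.homEquiv_comp F (𝟙 G)
  rw [Category.id_comp] at h
  exact h

/-- The comparison `P : A ⋆ B ⟶ A ⊗ B`. Under the correspondences between 2-functors
`A ⊗ B ⟶ C` and `A ⟶ Ps(B, C)`, and between 2-functors `A ⋆ B ⟶ C` and `A ⟶ [B, C]_f`,
precomposition with `P` is postcomposition with `J₂ : Ps(B, C) ⟶ [B, C]_f`; so `P` itself is the
2-functor `A ⋆ B ⟶ A ⊗ B` that corresponds to the composite of the universal 2-functor
`A ⟶ Ps(B, A ⊗ B)` with `J₂`. -/
noncomputable def comparison {inl : prod (ob A) B ⟶ S} {inr : prod A (ob B) ⟶ S}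
    (hS : IsFunnyTensor inl inr) (hG : GrayTensor A B G) : S ⟶ G :=
  IsPushout.desc hS (uncurryLeft (hG.transpose (𝟙 G) ≫ forgetPs B G))
    (uncurryRight (hG.transpose (𝟙 G) ≫ forgetPs B G)) (uncurry_w _)

theorem conj_heq {X : Type*} [Category* X] {a b c d : X} (h₁ : a = b) (f : b ⟶ c) (h₂ : c = d) :
    eqToHom h₁ ≫ f ≫ eqToHom h₂ ≍ f := by
  subst h₁ h₂
  simp

theorem whiskerRight_id_heq {X : Type*} [Bicategory X] [Strict X] {a b : X} {f g : a ⟶ b}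
    (η : f ⟶ g) : η ▷ 𝟙 b ≍ η := by
  rw [whiskerRight_id, Strict.rightUnitor_eqToIso, Strict.rightUnitor_eqToIso]
  exact conj_heq (Strict.comp_id f) η (Strict.comp_id g).symm

theorem map₂_heq {C D : TwoCat.{u}} (F : StrictPseudofunctor C D) {x y : C} {f g f' g' : x ⟶ y}
    (hf : f = f') (hg : g = g') {η : f ⟶ g} {η' : f' ⟶ g'} (h : η ≍ η') :
    F.map₂ η ≍ F.map₂ η' := by
  subst hf hg h
  rfl

theorem family_comp {C D : TwoCat.{u}} (L : A → (B ⟶ C)) (F : C ⟶ D) :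
    family L ≫ F = family fun a => L a ≫ F := by
  apply twoFunctor_ext
  · intro x; rfl
  · rintro ⟨⟨⟨a⟩⟩, b⟩ ⟨⟨⟨a'⟩⟩, b'⟩ ⟨⟨⟨⟨p⟩⟩⟩, g⟩
    dsimp at p
    subst p
    apply heq_of_eq
    change F.map ((L a).map g ≫ 𝟙 _) = F.map ((L a).map g) ≫ 𝟙 _
    rw [Strict.comp_id, Strict.comp_id]
  · rintro ⟨⟨⟨a⟩⟩, b⟩ ⟨⟨⟨a'⟩⟩, b'⟩ ⟨⟨⟨⟨p⟩⟩⟩, g⟩ ⟨⟨⟨⟨p'⟩⟩⟩, g'⟩ ⟨θ, η⟩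
    dsimp at p
    subst p
    change F.map₂ ((L a).map₂ η ▷ 𝟙 _) ≍ F.map₂ ((L a).map₂ η) ▷ 𝟙 _
    exact (map₂_heq F (Strict.comp_id _) (Strict.comp_id _) (whiskerRight_id_heq _)).trans
      (whiskerRight_id_heq _).symm

theorem uncurryLeft_comp {C D : TwoCat.{u}} (H : A ⟶ Ps B C) (F : C ⟶ D) :
    uncurryLeft (H ≫ forgetPs B C) ≫ F = uncurryLeft ((H ≫ psMap B F) ≫ forgetPs B D) :=
  family_comp _ F

theorem uncurryRight_comp {C D : TwoCat.{u}} (H : A ⟶ Ps B C) (F : C ⟶ D) :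
    uncurryRight (H ≫ forgetPs B C) ≫ F = uncurryRight ((H ≫ psMap B F) ≫ forgetPs B D) := by
  rw [uncurryRight, uncurryRight, Category.assoc, family_comp]
  congr 2
  funext b
  exact twoFunctor_ext (fun _ => rfl) (fun _ => HEq.rfl) (fun _ => HEq.rfl)

/-- For every 2-functor `F : A ⊗ B ⟶ C`, the 2-functor `F ∘ P : A ⋆ B ⟶ C` corresponds to the
composite of `J₂` with the 2-functor `A ⟶ Ps(B, C)` that corresponds to `F`. -/
theorem comparison_comp {inl : prod (ob A) B ⟶ S} {inr : prod A (ob B) ⟶ S}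
    (hS : IsFunnyTensor inl inr) (hG : GrayTensor A B G) {C : TwoCat.{u}} (F : G ⟶ C) :
    inl ≫ comparison hS hG ≫ F = uncurryLeft (hG.transpose F ≫ forgetPs B C) ∧
      inr ≫ comparison hS hG ≫ F = uncurryRight (hG.transpose F ≫ forgetPs B C) := by
  rw [hG.transpose_eq F, ← uncurryLeft_comp, ← uncurryRight_comp, comparison]
  exact ⟨IsPushout.inl_desc_assoc hS _ _ _ _, IsPushout.inr_desc_assoc hS _ _ _ _⟩

/-- A 2-functor is boba if it is bijective on objects and bijective on arrows (1-cells). -/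
structure IsBoba (F : A ⟶ B) : Prop where
  bijective_obj : Function.Bijective F.obj
  bijective_map (x y : A) : Function.Bijective (fun f : x ⟶ y => F.map f)

end Tensor

end TwoCat

/-! Every 2-functor P : S → G factors through its local image L, which has the objects and 1-cells
of S and the 2-cells of G between their images. The first factor is the identity on objects and
1-cells, the second is locally fully faithful. To show that the comparison P is boba it suffices to
find d : G → L with P followed by d equal to the first factor and d followed by the second factor
equal to the identity (`isBoba_of_localImage`): the first equation gives injectivity, the second
produces preimages.

With G = A ⊗ B, such a d amounts to a lift to Ps(B, L) of the universal 2-functor A → Ps(B, G). The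
objects and 1-cells that it involves, namely the values of the 2-functors B → G and the components
of the pseudonatural transformations, already come from A ⋆ B through the two legs of the pushout
(`psLift`). The pseudonaturality squares and the modifications consist of 2-cells, and L has all
those of G. Since a pseudonaturality square is filled by a 2-cell and need not commute, the lift of
1-cells has to be functorial only in each variable separately, and this is what the funny tensor
product provides. So the lift exists (`PsLift.toPs`) and projects to the universal 2-functor
(`PsLift.toPs_comp`); the two equations for d then follow from the universal properties of ⊗ and ⋆
(`exists_section`).

Objects and 1-cells of L carry their image as a separate field, so that the projection to G computes
definitionally and the axioms of G can be reused without transport. -/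

namespace TwoCat

/-! ### The local image of a 2-functor -/

section LocalImage

variable {S G : TwoCat.{u}}

/-- The objects of the local image of a 2-functor `P : S ⟶ G`: an object of `S` with its image. -/
structure LocalImage (P : S ⟶ G) : Type u where
  src : S
  tgt : G
  obj_src : P.obj src = tgt

namespace LocalImage

variable {P : S ⟶ G}

/-- A 1-cell of the local image: a 1-cell of `S` with its image. -/
structure Hom (X Y : LocalImage P) : Type u where
  src : X.src ⟶ Y.src
  tgt : X.tgt ⟶ Y.tgt
  map_src : P.map src ≍ tgt

/-- A 2-cell of the local image: an arbitrary 2-cell of `G` between the images. -/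
@[ext]
structure Hom₂ {X Y : LocalImage P} (f g : Hom X Y) : Type u where
  as : f.tgt ⟶ g.tgt

theorem map_id_heq (X : LocalImage P) : P.map (𝟙 X.src) ≍ 𝟙 X.tgt := by
  obtain ⟨x, _, rfl⟩ := X
  exact heq_of_eq (P.map_id x)

theorem map_comp_heq {X Y Z : LocalImage P} (f : Hom X Y) (g : Hom Y Z) :
    P.map (f.src ≫ g.src) ≍ f.tgt ≫ g.tgt := by
  obtain ⟨x, _, rfl⟩ := X
  obtain ⟨y, _, rfl⟩ := Y
  obtain ⟨z, _, rfl⟩ := Z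
  obtain ⟨f, f', hf⟩ := f
  obtain ⟨g, g', hg⟩ := g
  obtain rfl := eq_of_heq hf
  obtain rfl := eq_of_heq hg
  exact heq_of_eq (P.map_comp f g)

instance : CategoryStruct (LocalImage P) where
  Hom X Y := Hom X Y
  id X := ⟨𝟙 X.src, 𝟙 X.tgt, map_id_heq X⟩
  comp f g := ⟨f.src ≫ g.src, f.tgt ≫ g.tgt, map_comp_heq f g⟩

instance (X Y : LocalImage P) : Category (X ⟶ Y) where
  Hom f g := Hom₂ f g
  id f := ⟨𝟙 f.tgt⟩
  comp η θ := ⟨η.as ≫ θ.as⟩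
  id_comp _ := Hom₂.ext (Category.id_comp _)
  comp_id _ := Hom₂.ext (Category.comp_id _)
  assoc _ _ _ := Hom₂.ext (Category.assoc _ _ _)

theorem obj_ext {X Y : LocalImage P} (h : X.src = Y.src) : X = Y := by
  obtain ⟨x, _, rfl⟩ := X
  obtain ⟨y, _, rfl⟩ := Y
  obtain rfl : x = y := h
  rfl

/-- The image field is forced by `map_src`, so it adds no information. -/
theorem hom_ext {X Y : LocalImage P} {f g : X ⟶ Y} (h : f.src = g.src) : f = g := by
  obtain ⟨f, f', hf⟩ := f
  obtain ⟨g, g', hg⟩ := g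
  obtain rfl : f = g := h
  obtain rfl := eq_of_heq (hf.symm.trans hg)
  rfl

theorem hom_heq {X Y X' Y' : LocalImage P} (hX : X = X') (hY : Y = Y') {f : X ⟶ Y} {g : X' ⟶ Y'}
    (h : f.src ≍ g.src) : f ≍ g := by
  subst hX hY
  exact heq_of_eq (hom_ext (eq_of_heq h))

theorem hom₂_ext {X Y : LocalImage P} {f g : X ⟶ Y} {η θ : f ⟶ g} (h : η.as = θ.as) : η = θ :=
  Hom₂.ext h

theorem hom₂_heq {X Y X' Y' : LocalImage P} (hX : X = X') (hY : Y = Y') {f g : X ⟶ Y}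
    {f' g' : X' ⟶ Y'} (hf : f ≍ f') (hg : g ≍ g') {η : f ⟶ g} {θ : f' ⟶ g'}
    (h : η.as ≍ θ.as) : η ≍ θ := by
  subst hX hY hf hg
  exact heq_of_eq (hom₂_ext (eq_of_heq h))

/-- An invertible 2-cell of the local image, from an invertible 2-cell of `G`. -/
def isoMk {X Y : LocalImage P} {f g : X ⟶ Y} (e : f.tgt ≅ g.tgt) : f ≅ g where
  hom := Hom₂.mk e.hom
  inv := Hom₂.mk e.inv
  hom_inv_id := hom₂_ext e.hom_inv_id
  inv_hom_id := hom₂_ext e.inv_hom_id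

/-- Transfers strictness from `G`: a structural isomorphism that is an identity up to transport in
`G` is one in the local image, once the two 1-cells are known to agree there. -/
theorem isoMk_eqToIso {X Y : LocalImage P} {f g : X ⟶ Y} {e : f.tgt ≅ g.tgt} (h : f = g)
    (he : e = eqToIso (by rw [h])) : isoMk e = eqToIso h := by
  subst h he
  rfl

instance : Bicategory.{u, u} (LocalImage P) where
  whiskerLeft f _ _ η := Hom₂.mk (Hom.tgt f ◁ Hom₂.as η)
  whiskerRight η h := Hom₂.mk (Hom₂.as η ▷ Hom.tgt h)
  associator f g h := isoMk (α_ f.tgt g.tgt h.tgt)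
  leftUnitor f := isoMk (λ_ f.tgt)
  rightUnitor f := isoMk (ρ_ f.tgt)
  whiskerLeft_id _ _ := hom₂_ext (whiskerLeft_id _ _)
  whiskerLeft_comp _ _ _ _ _ _ := hom₂_ext (whiskerLeft_comp _ _ _)
  id_whiskerLeft _ := hom₂_ext (id_whiskerLeft _)
  comp_whiskerLeft _ _ _ _ _ := hom₂_ext (comp_whiskerLeft _ _ _)
  id_whiskerRight _ _ := hom₂_ext (id_whiskerRight _ _)
  comp_whiskerRight _ _ _ := hom₂_ext (comp_whiskerRight _ _ _)
  whiskerRight_id _ := hom₂_ext (whiskerRight_id _)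
  whiskerRight_comp _ _ _ := hom₂_ext (whiskerRight_comp _ _ _)
  whisker_assoc _ _ _ _ _ := hom₂_ext (whisker_assoc _ _ _)
  whisker_exchange _ _ := hom₂_ext (whisker_exchange _ _)
  pentagon _ _ _ _ := hom₂_ext (pentagon _ _ _ _)
  triangle _ _ := hom₂_ext (triangle _ _)

/-- Equations between 1-cells are inherited from `S`, those between structural 2-cells from `G`. -/
instance : Strict (LocalImage P) where
  id_comp _ := hom_ext (Strict.id_comp _)
  comp_id _ := hom_ext (Strict.comp_id _)
  assoc _ _ _ := hom_ext (Strict.assoc _ _ _)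
  leftUnitor_eqToIso _ := isoMk_eqToIso _ (Strict.leftUnitor_eqToIso _)
  rightUnitor_eqToIso _ := isoMk_eqToIso _ (Strict.rightUnitor_eqToIso _)
  associator_eqToIso _ _ _ := isoMk_eqToIso _ (Strict.associator_eqToIso _ _ _)

end LocalImage

/-- The local image of a 2-functor `P : S ⟶ G`: it has the objects and the 1-cells of `S`, and the
2-cells of `G` between their images. -/
def localImage (P : S ⟶ G) : TwoCat.{u} := ⟨LocalImage P⟩

/-! ### The factorization of a 2-functor through its local image -/

namespace LocalImage

variable (P : S ⟶ G)

/-- The locally fully faithful part of the factorization of `P` through its local image. -/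
def toTarget : localImage P ⟶ G :=
  StrictPseudofunctor.mk'' (B := LocalImage P) (C := G)
    { obj := fun X => X.tgt
      map := fun f => Hom.tgt f
      map₂ := fun η => Hom₂.as η
      map₂_id := by intros; rfl
      map₂_comp := by intros; rfl
      map_id := by intros; rfl
      map_comp := by intros; rfl
      map₂_whisker_left := by
        intros; rw [eqToHom_refl, eqToHom_refl, Category.id_comp, Category.comp_id]; rfl
      map₂_whisker_right := by
        intros; rw [eqToHom_refl, eqToHom_refl, Category.id_comp, Category.comp_id]; rfl }

variable {P}

/-- A 2-functor into the local image of `P`, from a 2-functor `F` into the target of `P` with a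
lift of its underlying functor along `P`. -/
def lift {X : Type u} [Bicategory.{u, u} X] (F : StrictPseudofunctor X G) (o : X → S)
    (m : ∀ {x y : X}, (x ⟶ y) → (o x ⟶ o y)) (m_id : ∀ x, m (𝟙 x) = 𝟙 (o x))
    (m_comp : ∀ {x y z : X} (f : x ⟶ y) (g : y ⟶ z), m (f ≫ g) = m f ≫ m g)
    (ho : ∀ x, P.obj (o x) = F.obj x)
    (hm : ∀ {x y : X} (f : x ⟶ y), P.map (m f) ≍ F.map f) :
    StrictPseudofunctor X (LocalImage P) where
  obj x := ⟨o x, F.obj x, ho x⟩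
  map f := Hom.mk (m f) (F.map f) (hm f)
  map₂ η := Hom₂.mk (F.map₂ η)
  map₂_id f := hom₂_ext (F.map₂_id f)
  map₂_comp η θ := hom₂_ext (F.map₂_comp η θ)
  mapId x := isoMk (F.mapId x)
  mapComp f g := isoMk (F.mapComp f g)
  map₂_whisker_left f _ _ η := hom₂_ext (F.map₂_whisker_left f η)
  map₂_whisker_right η h := hom₂_ext (F.map₂_whisker_right η h)
  map₂_associator f g h := hom₂_ext (F.map₂_associator f g h)
  map₂_left_unitor f := hom₂_ext (F.map₂_left_unitor f)
  map₂_right_unitor f := hom₂_ext (F.map₂_right_unitor f)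
  map_id x := hom_ext (m_id x)
  mapId_eq_eqToIso x := isoMk_eqToIso _ (F.mapId_eq_eqToIso x)
  map_comp f g := hom_ext (m_comp f g)
  mapComp_eq_eqToIso f g := isoMk_eqToIso _ (F.mapComp_eq_eqToIso f g)

variable (P) in
/-- The boba part of the factorization of `P` through its local image. -/
def ofSource : S ⟶ localImage P :=
  lift P (fun x => x) (fun f => f) (fun _ => rfl) (fun _ _ => rfl) (fun _ => rfl)
    (fun _ => HEq.rfl)

theorem ofSource_toTarget : ofSource P ≫ toTarget P = P :=
  twoFunctor_ext (fun _ => rfl) (fun _ => HEq.rfl) (fun _ => HEq.rfl)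

theorem tgt_heq {X Y X' Y' : LocalImage P} (hX : X = X') (hY : Y = Y') {f : X ⟶ Y} {g : X' ⟶ Y'}
    (h : f ≍ g) : Hom.tgt f ≍ Hom.tgt g := by
  subst hX hY h
  rfl

end LocalImage

/-! ### Equality of 2-functors into the local image, and the criterion for being boba -/

theorem obj_congr {C D : TwoCat.{u}} {F F' : C ⟶ D} (h : F = F') (x : C) :
    F.obj x = F'.obj x := by
  rw [h]

theorem map_congr {C D : TwoCat.{u}} {F F' : C ⟶ D} (h : F = F') {x y : C} (f : x ⟶ y) :
    F.map f ≍ F'.map f := by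
  rw [h]

theorem map₂_congr {C D : TwoCat.{u}} {F F' : C ⟶ D} (h : F = F') {x y : C} {f g : x ⟶ y}
    (η : f ⟶ g) : F.map₂ η ≍ F'.map₂ η := by
  rw [h]

theorem map_heq {C D : TwoCat.{u}} (F : C ⟶ D) {x y x' y' : C} (hx : x = x') (hy : y = y')
    {f : x ⟶ y} {g : x' ⟶ y'} (h : f ≍ g) : F.map f ≍ F.map g := by
  subst hx hy h
  rfl

/-- Objects and 1-cells of the local image are determined by their parts in `S`, and 2-cells by
their images in `G`; the projection to `G` is needed only for the latter. -/
theorem LocalImage.functor_ext {P : S ⟶ G} {X : TwoCat.{u}} {F F' : X ⟶ localImage P}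
    (h : F ≫ toTarget P = F' ≫ toTarget P)
    (hobj : ∀ x, LocalImage.src (P := P) (F.obj x) = LocalImage.src (P := P) (F'.obj x))
    (hmap : ∀ {x y : X} (f : x ⟶ y),
      Hom.src (P := P) (F.map f) ≍
        Hom.src (P := P) (F'.map f)) : F = F' := by
  have ho : ∀ x, F.obj x = F'.obj x := fun x => obj_ext (hobj x)
  have hm : ∀ {x y : X} (f : x ⟶ y), F.map f ≍ F'.map f :=
    fun f => hom_heq (ho _) (ho _) (hmap f)
  exact twoFunctor_ext ho hm fun η =>
    hom₂_heq (ho _) (ho _) (hm _) (hm _) (map₂_congr h η)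

/-- Since `ofSource P` is injective on objects and 1-cells, `h₁` makes `P` injective on them.
Conversely, `d` sends a cell of `G` to a cell of `S` paired with its image under `P`, and `h₂`
identifies that image with the given cell. -/
theorem isBoba_of_localImage {P : S ⟶ G} (d : G ⟶ localImage P)
    (h₁ : P ≫ d = LocalImage.ofSource P) (h₂ : d ≫ LocalImage.toTarget P = 𝟙 G) : IsBoba P := by
  have ho : ∀ x, d.obj (P.obj x) = (LocalImage.ofSource P).obj x := obj_congr h₁
  refine ⟨⟨fun x y h => ?_, fun y => ?_⟩, fun x y => ⟨fun f g h => ?_, fun k => ?_⟩⟩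
  · have h' : (LocalImage.ofSource P).obj x = (LocalImage.ofSource P).obj y :=
      (ho x).symm.trans ((congrArg d.obj h).trans (ho y))
    exact congrArg LocalImage.src h'
  · exact ⟨LocalImage.src (P := P) (d.obj y),
      (LocalImage.obj_src (P := P) (d.obj y)).trans (obj_congr h₂ y)⟩
  · have h' : (LocalImage.ofSource P).map f = (LocalImage.ofSource P).map g :=
      eq_of_heq ((map_congr h₁ f).symm.trans
        ((heq_of_eq (congrArg d.map h)).trans (map_congr h₁ g)))
    exact congrArg LocalImage.Hom.src h'
  -- The endpoints of `d.map k` equal the images of `x` and `y` only by `h₁`; after the cast, the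
  -- `S`-part of `k'` is a 1-cell from `x` to `y`.
  · obtain ⟨k', hk'⟩ : ∃ k' : (LocalImage.ofSource P).obj x ⟶ (LocalImage.ofSource P).obj y,
        k' ≍ d.map k := ⟨cast (by rw [ho, ho]) (d.map k), cast_heq _ _⟩
    refine ⟨LocalImage.Hom.src k', eq_of_heq ((LocalImage.Hom.map_src k').trans ?_)⟩
    exact (LocalImage.tgt_heq (ho x).symm (ho y).symm hk').trans (map_congr h₂ k)

end LocalImage

open scoped Pseudofunctor.StrongTrans

/-! ### Lifting a 2-functor `A ⟶ Ps B G` along the projection from the local image -/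

section PsLift

variable {A B S G : TwoCat.{u}}

/-- The 2-functor `B ⟶ G` at an object of `A` that a 2-functor `A ⟶ Ps(B, G)` assigns. -/
abbrev psFunctorAt (T : A ⟶ Ps B G) (a : A) : StrictPseudofunctor B G := T.obj a

/-- The pseudonatural transformation at a 1-cell of `A` that a 2-functor `A ⟶ Ps(B, G)` assigns. -/
abbrev psTransAt (T : A ⟶ Ps B G) {a a' : A} (f : a ⟶ a') :
    (psFunctorAt T a).toPseudofunctor ⟶ (psFunctorAt T a').toPseudofunctor :=
  InducedBicategory.Hom.hom (C := Pseudofunctor B G)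
    (F := fun F : StrictPseudofunctor B G => F.toPseudofunctor)
    (X := T.obj a) (Y := T.obj a') (T.map f)

/-- The component of a modification at an object. -/
abbrev psModApp {F F' : PsObj B G} {α β : F ⟶ F'} (Γ : α ⟶ β) (b : B) :
    α.hom.app b ⟶ β.hom.app b :=
  Γ.hom.as.app b

/-- A lift along `P : S ⟶ G` of the objects and the 1-cells of a 2-functor `T : A ⟶ Ps(B, G)`,
functorial in each variable separately. -/
structure PsLift (P : S ⟶ G) (T : A ⟶ Ps B G) where
  obj (a : A) (b : B) : S
  left (a : A) {b b' : B} (g : b ⟶ b') : obj a b ⟶ obj a b'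
  right {a a' : A} (f : a ⟶ a') (b : B) : obj a b ⟶ obj a' b
  left_id (a : A) (b : B) : left a (𝟙 b) = 𝟙 (obj a b)
  left_comp (a : A) {b b' b'' : B} (g : b ⟶ b') (h : b' ⟶ b'') :
    left a (g ≫ h) = left a g ≫ left a h
  right_id (a : A) (b : B) : right (𝟙 a) b = 𝟙 (obj a b)
  right_comp {a a' a'' : A} (f : a ⟶ a') (h : a' ⟶ a'') (b : B) :
    right (f ≫ h) b = right f b ≫ right h b
  obj_eq (a : A) (b : B) : P.obj (obj a b) = (psFunctorAt T a).obj b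
  left_heq (a : A) {b b' : B} (g : b ⟶ b') :
    P.map (left a g) ≍ (psFunctorAt T a).map g
  right_heq {a a' : A} (f : a ⟶ a') (b : B) :
    P.map (right f b) ≍ (psTransAt T f).app b

namespace PsLift

variable {P : S ⟶ G} {T : A ⟶ Ps B G} (D : PsLift P T)

/-- The 2-functor `B ⟶ localImage P` at an object of `A`. -/
def functor (a : A) : PsObj B (localImage P) :=
  LocalImage.lift (P := P) (X := B) (T.obj a) (D.obj a) (D.left a) (D.left_id a) (D.left_comp a)
    (D.obj_eq a) (D.left_heq a)

/-- The pseudonatural transformation at a 1-cell of `A`. -/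
def trans {a a' : A} (f : a ⟶ a') :
    (D.functor a).toPseudofunctor ⟶ (D.functor a').toPseudofunctor :=
  Pseudofunctor.StrongTrans.mk (B := B) (C := LocalImage P)
    (fun b => LocalImage.Hom.mk (D.right f b) ((psTransAt T f).app b)
      (D.right_heq f b))
    -- No compatibility between `D.left` and `D.right` is needed: the square in `S` need not
    -- commute, and the filler in `G` is already a 2-cell of the local image.
    (fun g => LocalImage.isoMk ((psTransAt T f).naturality g))
    (fun η => LocalImage.hom₂_ext
      ((psTransAt T f).naturality_naturality η))
    (fun b => LocalImage.hom₂_ext ((psTransAt T f).naturality_id b))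
    (fun g h => LocalImage.hom₂_ext ((psTransAt T f).naturality_comp g h))

/-- The modification at a 2-cell of `A`. -/
def modification {a a' : A} {f f' : a ⟶ a'} (η : f ⟶ f') : D.trans f ⟶ D.trans f' :=
  Pseudofunctor.StrongTrans.Hom.of
    (Pseudofunctor.StrongTrans.Modification.mk
      (fun b => LocalImage.Hom₂.mk (psModApp (T.map₂ η) b))
      (fun g => LocalImage.hom₂_ext ((InducedBicategory.Hom₂.hom (T.map₂ η)).as.naturality g)))

/-- The 1-cell of `Ps(B, localImage P)` at a 1-cell of `A`. -/
def transHom {a a' : A} (f : a ⟶ a') : D.functor a ⟶ D.functor a' :=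
  InducedBicategory.mkHom (D.trans f)

theorem ps_naturality_heq {C : TwoCat.{u}} {F F' : PsObj B C} {α β : F ⟶ F'} (h : α = β)
    {b b' : B} (g : b ⟶ b') : (α.hom.naturality g).hom ≍ (β.hom.naturality g).hom := by
  rw [h]

/-- Separates the part of an equation of pseudonatural transformations that lives in `S` from the
part that lives in `G`, so that functoriality of `transHom` follows from that of `D.right` and of
`T`. -/
theorem trans_ext {F F' : PsObj B (localImage P)} {α β : F ⟶ F'}
    (happ : ∀ x, LocalImage.Hom.src (P := P) (α.hom.app x) =
      LocalImage.Hom.src (P := P) (β.hom.app x))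
    (hnat : ∀ {x y : B} (f : x ⟶ y),
      LocalImage.Hom₂.as (P := P) (α.hom.naturality f).hom ≍
        LocalImage.Hom₂.as (P := P) (β.hom.naturality f).hom) : α = β := by
  have h : ∀ x, α.hom.app x = β.hom.app x := fun x => LocalImage.hom_ext (happ x)
  refine eq_of_heq (ps_hom_heq rfl rfl (fun x => heq_of_eq (h x)) fun {x y} f => ?_)
  refine LocalImage.hom₂_heq rfl rfl ?_ ?_ (hnat f)
  · rw [h y]; rfl
  · rw [h x]; rfl

theorem transHom_id (a : A) : D.transHom (𝟙 a) = 𝟙 (D.functor a) :=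
  trans_ext (D.right_id a) fun g =>
    ps_naturality_heq (α := T.map (𝟙 a)) (T.map_id a) g

theorem transHom_comp {a a' a'' : A} (f : a ⟶ a') (f' : a' ⟶ a'') :
    D.transHom (f ≫ f') = D.transHom f ≫ D.transHom f' :=
  trans_ext (D.right_comp f f') fun g =>
    ps_naturality_heq (α := T.map (f ≫ f')) (T.map_comp f f') g

theorem localImage_conj_as {X Y : LocalImage P} {f f' g g' : X ⟶ Y} (h₁ : f = f')
    (η : f' ⟶ g') (h₂ : g' = g) :
    (eqToHom h₁ ≫ η ≫ eqToHom h₂).as = eqToHom (by rw [h₁]) ≫ η.as ≫ eqToHom (by rw [h₂]) := by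
  subst h₁ h₂
  simp only [eqToHom_refl, Category.id_comp, Category.comp_id]

/-- The 2-functor `A ⟶ Ps(B, localImage P)`. -/
def toPs : A ⟶ Ps B (localImage P) :=
  StrictPseudofunctor.mk'' (B := A) (C := PsObj B (localImage P))
    { obj := fun a => D.functor a
      map := fun f => D.transHom f
      map₂ := fun η => InducedBicategory.mkHom₂ (D.modification η)
      map₂_id := by
        intro a a' f
        apply InducedBicategory.hom₂_ext
        apply Pseudofunctor.StrongTrans.homCategory.ext
        intro x
        apply LocalImage.hom₂_ext
        exact congrArg (fun Γ => psModApp Γ x) (T.map₂_id f)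
      map₂_comp := by
        intro a a' f g h η θ
        apply InducedBicategory.hom₂_ext
        apply Pseudofunctor.StrongTrans.homCategory.ext
        intro x
        apply LocalImage.hom₂_ext
        exact congrArg (fun Γ => psModApp Γ x) (T.map₂_comp η θ)
      map_id := D.transHom_id
      map_comp := D.transHom_comp
      map₂_whisker_left := by
        intro a a' a'' f g g' η
        apply InducedBicategory.hom₂_ext
        apply Pseudofunctor.StrongTrans.homCategory.ext
        intro x
        refine Eq.trans ?_ (ps_conj _ _ _ x).symm
        apply LocalImage.hom₂_ext
        refine Eq.trans ?_ (localImage_conj_as _ _ _).symm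
        -- Both sides are now conjugates, in `G`, by transports along equalities of 1-cells, so the
        -- whiskering law of `T`, evaluated at `x`, is the goal.
        have h := T.map₂_whisker_left f η
        rw [T.mapComp_eq_eqToIso, T.mapComp_eq_eqToIso] at h
        exact (congrArg (fun Γ => psModApp Γ x) h).trans
          (ps_conj (T.map_comp f g) _ (T.map_comp f g').symm x)
      map₂_whisker_right := by
        intro a a' a'' f f' η g
        apply InducedBicategory.hom₂_ext
        apply Pseudofunctor.StrongTrans.homCategory.ext
        intro x
        refine Eq.trans ?_ (ps_conj _ _ _ x).symm
        apply LocalImage.hom₂_ext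
        refine Eq.trans ?_ (localImage_conj_as _ _ _).symm
        have h := T.map₂_whisker_right η g
        rw [T.mapComp_eq_eqToIso, T.mapComp_eq_eqToIso] at h
        exact (congrArg (fun Γ => psModApp Γ x) h).trans
          (ps_conj (T.map_comp f g) _ (T.map_comp f' g).symm x) }

theorem functor_comp (a : A) :
    StrictPseudofunctor.comp (D.functor a) (LocalImage.toTarget P) = T.obj a :=
  twoFunctor_ext (fun _ => rfl) (fun _ => HEq.rfl) (fun _ => HEq.rfl)

theorem toPs_map_heq {a a' : A} (f : a ⟶ a') :
    (psMap B (LocalImage.toTarget P)).map (D.toPs.map f) ≍ T.map f := by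
  refine ps_hom_heq (D.functor_comp a) (D.functor_comp a') (fun x => HEq.rfl) fun g => ?_
  apply heq_of_eq
  -- The composition constraints of `toTarget P` are identities by definition.
  change 𝟙 _ ≫ ((psTransAt T f).naturality g).hom ≫ 𝟙 _ = _
  rw [Category.id_comp, Category.comp_id]

theorem toPs_comp : D.toPs ≫ psMap B (LocalImage.toTarget P) = T :=
  twoFunctor_ext D.functor_comp D.toPs_map_heq fun _ =>
    ps_hom₂_heq (D.functor_comp _) (D.functor_comp _) (D.toPs_map_heq _) (D.toPs_map_heq _)
      fun _ => HEq.rfl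

end PsLift

end PsLift

/-! ### The lift for the comparison, and the resulting map out of the Gray tensor product -/

section Comparison

variable {A B S G : TwoCat.{u}}

theorem comp_heq_comp {C : TwoCat.{u}} {x y z x' y' z' : C} (hx : x = x') (hy : y = y')
    (hz : z = z') {f : x ⟶ y} {g : y ⟶ z} {f' : x' ⟶ y'} {g' : y' ⟶ z'} (hf : f ≍ f')
    (hg : g ≍ g') : f ≫ g ≍ f' ≫ g' := by
  subst hx hy hz hf hg
  rfl

variable {inl : prod (ob A) B ⟶ S} {inr : prod A (ob B) ⟶ S}

/-- The object of `ob A` at an object of `A`. -/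
abbrev obMk (a : A) : ob A := (⟨⟨a⟩⟩ : LocallyDiscrete (Discrete A))

theorem IsFunnyTensor.obj_eq (hS : IsFunnyTensor inl inr) (a : A) (b : B) :
    inl.obj (obMk a, b) = inr.obj (a, obMk b) :=
  obj_congr hS.w (obMk a, obMk b)

/-- The 1-cell of the funny tensor product at a 1-cell of `A` and an object of `B`, between the
objects given by the left leg. -/
def IsFunnyTensor.right (hS : IsFunnyTensor inl inr) {a a' : A} (f : a ⟶ a') (b : B) :
    inl.obj (obMk a, b) ⟶ inl.obj (obMk a', b) :=
  -- The two legs agree on objects only by commutativity of the pushout square.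
  cast (by rw [hS.obj_eq, hS.obj_eq])
    (inr.map (X := (a, obMk b)) (Y := (a', obMk b)) (f, 𝟙 (obMk b)))

theorem IsFunnyTensor.right_heq (hS : IsFunnyTensor inl inr) {a a' : A} (f : a ⟶ a') (b : B) :
    hS.right f b ≍ inr.map (X := (a, obMk b)) (Y := (a', obMk b)) (f, 𝟙 (obMk b)) :=
  cast_heq _ _

theorem comparison_inl (hS : IsFunnyTensor inl inr) (hG : GrayTensor A B G) :
    inl ≫ comparison hS hG = uncurryLeft (hG.transpose (𝟙 G) ≫ forgetPs B G) :=
  IsPushout.inl_desc hS _ _ _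

theorem comparison_inr (hS : IsFunnyTensor inl inr) (hG : GrayTensor A B G) :
    inr ≫ comparison hS hG = uncurryRight (hG.transpose (𝟙 G) ≫ forgetPs B G) :=
  IsPushout.inr_desc hS _ _ _

/-- The transport that `family` inserts is an identity on this 1-cell. -/
theorem uncurryLeft_map_heq {C : TwoCat.{u}} (T : A ⟶ Ps B C) {a : A} {b b' : B} (g : b ⟶ b') :
    (uncurryLeft (T ≫ forgetPs B C)).map (X := (obMk a, b)) (Y := (obMk a, b'))
      (𝟙 (obMk a), g) ≍ (psFunctorAt T a).map g :=
  heq_of_eq (Strict.comp_id ((psFunctorAt T a).map g))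

theorem uncurryRight_map_heq {C : TwoCat.{u}} (T : A ⟶ Ps B C) {a a' : A} (f : a ⟶ a') (b : B) :
    (uncurryRight (T ≫ forgetPs B C)).map (X := (a, obMk b)) (Y := (a', obMk b))
      (f, 𝟙 (obMk b)) ≍ (psTransAt T f).app b :=
  heq_of_eq (Strict.comp_id ((psTransAt T f).app b))

/-- The lift along the comparison of the universal 2-functor `A ⟶ Ps(B, A ⊗ B)`. -/
def psLift (hS : IsFunnyTensor inl inr) (hG : GrayTensor A B G) :
    PsLift (comparison hS hG) (hG.transpose (𝟙 G)) where
  obj a b := inl.obj (obMk a, b)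
  left a b b' g := inl.map (X := (obMk a, b)) (Y := (obMk a, b')) (𝟙 (obMk a), g)
  right f b := hS.right f b
  left_id a b := inl.map_id (obMk a, b)
  left_comp a b b' b'' g h := inl.map_comp (a := (obMk a, b)) (b := (obMk a, b'))
    (c := (obMk a, b'')) (𝟙 (obMk a), g) (𝟙 (obMk a), h)
  right_id a b := eq_of_heq ((hS.right_heq _ _).trans
    ((heq_of_eq (inr.map_id (a, obMk b))).trans (id_heq (hS.obj_eq a b).symm)))
  right_comp {a a' a''} f h b := eq_of_heq ((hS.right_heq _ _).trans
    ((heq_of_eq (inr.map_comp (a := (a, obMk b)) (b := (a', obMk b)) (c := (a'', obMk b))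
      (f, 𝟙 (obMk b)) (h, 𝟙 (obMk b)))).trans
    (comp_heq_comp (hS.obj_eq a b).symm (hS.obj_eq a' b).symm (hS.obj_eq a'' b).symm
      (hS.right_heq f b).symm (hS.right_heq h b).symm)))
  obj_eq a b := obj_congr (comparison_inl hS hG) (obMk a, b)
  left_heq _ _ _ g := (map_congr (comparison_inl hS hG) _).trans (uncurryLeft_map_heq _ g)
  right_heq {a a'} f b :=
    (map_heq _ (hS.obj_eq a b) (hS.obj_eq a' b) (hS.right_heq f b)).trans
      ((map_congr (comparison_inr hS hG) _).trans (uncurryRight_map_heq _ f b))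

/-- Here `d` is the 2-functor whose transpose is the lifted universal 2-functor. One equation is
checked after transposing, the other on the two legs of the pushout. -/
theorem exists_section (hS : IsFunnyTensor inl inr) (hG : GrayTensor A B G) :
    ∃ d : G ⟶ localImage (comparison hS hG),
      comparison hS hG ≫ d = LocalImage.ofSource _ ∧ d ≫ LocalImage.toTarget _ = 𝟙 G := by
  let T := (psLift hS hG).toPs
  obtain ⟨d, hd⟩ := hG.homEquiv.surjective T
  have hd₂ : d ≫ LocalImage.toTarget (comparison hS hG) = 𝟙 G := by
    -- By naturality, the transpose of the composite is the lift followed by the projection, which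
    -- is again the universal 2-functor.
    apply hG.homEquiv.injective
    rw [hG.homEquiv_comp, hd]
    exact (psLift hS hG).toPs_comp
  have hd₁ : (comparison hS hG ≫ d) ≫ LocalImage.toTarget (comparison hS hG) =
      LocalImage.ofSource _ ≫ LocalImage.toTarget (comparison hS hG) := by
    rw [Category.assoc, hd₂, Category.comp_id, LocalImage.ofSource_toTarget]
  -- This describes `comparison hS hG ≫ d` on each leg through the explicit lift `T`, whose parts in
  -- `S` are `inl` and `inr` by construction. With `hd₁` settling the 2-cells, only objects and
  -- 1-cells of `S` remain to be compared.
  obtain ⟨hl, hr⟩ := comparison_comp hS hG d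
  rw [show hG.transpose d = T from hd] at hl hr
  refine ⟨d, hS.hom_ext ?_ ?_, hd₂⟩
  · apply LocalImage.functor_ext
    · rw [Category.assoc, hd₁, Category.assoc]
    · intro x
      rw [hl]
      rfl
    · rw [hl]
      rintro ⟨⟨⟨a⟩⟩, b⟩ ⟨⟨⟨a'⟩⟩, b'⟩ ⟨⟨⟨⟨p⟩⟩⟩, g⟩
      dsimp at p
      subst p
      exact heq_of_eq (Strict.comp_id (B := S) _)
  · apply LocalImage.functor_ext
    · rw [Category.assoc, hd₁, Category.assoc]
    · rintro ⟨a, ⟨⟨b⟩⟩⟩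
      rw [hr]
      exact hS.obj_eq a b
    · rw [hr]
      rintro ⟨a, ⟨⟨b⟩⟩⟩ ⟨a', ⟨⟨b'⟩⟩⟩ ⟨f, ⟨⟨⟨p⟩⟩⟩⟩
      dsimp at p
      subst p
      -- Unlike on the left leg, the cast in `hS.right` has to be undone here.
      exact (heq_of_eq (Strict.comp_id _)).trans (hS.right_heq f b)

end Comparison

end TwoCat

/-- For all 2-categories `A` and `B`, with `S = A ⋆ B` any funny tensor product and `G = A ⊗ B` any
Gray tensor product, the comparison `P : A ⋆ B ⟶ A ⊗ B` is boba. -/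
theorem mainTheorem5 {A B S G : TwoCat.{u}}
    {inl : TwoCat.prod (TwoCat.ob A) B ⟶ S} {inr : TwoCat.prod A (TwoCat.ob B) ⟶ S}
    (hS : TwoCat.IsFunnyTensor inl inr) (hG : TwoCat.GrayTensor A B G) :
    TwoCat.IsBoba (TwoCat.comparison hS hG) := by
  obtain ⟨d, h₁, h₂⟩ := TwoCat.exists_section hS hG
  exact TwoCat.isBoba_of_localImage d h₁ h₂
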